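/- Let $\Omega\subset\mathbb R^2$ be a nonempty bounded convex open set. Let $\mathcal A\in L^\infty(\Omega)^{2\times2}$ be symmetric with $\xi^T\mathcal A(x)\xi\ge\alpha\,\xi^T\xi$ for a.e. $x\in\Omega$ and all $\xi\in\mathbb R^2$, for some $\alpha>0$, and let $V\in L^2(\Omega)$ with $V\ge0$. Let $F\in C^1[0,\infty)\cap C^2(0,\infty)$ with $\inf_{t>0}F''(t)>0$, put $f=F'$, and suppose that $|f(t)|\le C(1+t^q)$ for all $t\ge0$, with some $q\in[0,2)$ and some constant $C$. Let $u\ge 0$ be a minimizer of $$E(v)=\tfrac12(\mathcal A\nabla v,\nabla v)+\tfrac12(Vv,v)+\tfrac12\int_\Omega F(v^2)\,dx$$ over all $v\in H^1_0(\Omega)$ with $\int_\Omega v^2\,dx=1$. Let $\mathcal T_h$ be a finite partition of $\Omega$ into simple polygons $T$ with diameters $h_T$, any two of which meet only in common edges and vertices (a hanging node counts as a vertex of every polygon that it lies on), let $\mathcal E_h$ be its set of edges, $k\ge1$ an integer and $\varepsilon\in(0,1)$. Let $$V_h=\{v=\{v_0,v_b\}:\ v_0|_T\in P_k(T)\ \forall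 T\in\mathcal T_h,\ v_b|_e\in P_{k-1}(e)\ \forall e\in\mathcal E_h,\ v_b|_{\partial\Omega}=0\}.$$ For $v\in V_h$ let $\nabla_wv|_T\in[P_{k-1}(T)]^2$ be defined by $$(\nabla_wv,q)_T=-(v_0,\nabla\cdot q)_T+\langle v_b,q\cdot\mathbf n\rangle_{\partial T}\qquad\forall q\in[P_{k-1}(T)]^2,$$ where $\mathbf n$ is the outward unit normal, let $Q_b$ be the $L^2(e)$-projection onto $P_{k-1}(e)$ on each edge $e$, let $(v,w)=\int_\Omega v_0w_0\,dx$, and $$\langle A_h^uv,w\rangle=(\mathcal A\nabla_wv,\nabla_ww)+\int_\Omega Vv_0w_0\,dx+\sum_{T\in\mathcal T_h}h_T^{-1+\varepsilon}\langle Q_bv_0-v_b,Q_bw_0-w_b\rangle_{\partial T}+\int_\Omega f(u^2)v_0w_0\,dx .$$ Let $(\widetilde u_h,\widetilde\lambda_h)$ be a first eigenpair of $A_h^u$, that is, $0\ne\widetilde u_h\in V_h$, $\langle A_h^u\widetilde u_h,v_h\rangle=\widetilde\lambda_h(\widetilde u_h,v_h)$ for all $v_h\in V_h$, and $\widetilde\lambda_h\in\mathbb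 R$ is the smallest number for which such a nonzero vector exists. Then $$\langle(A_h^u-\widetilde\lambda_h)v_h,v_h\rangle:=\langle A_h^uv_h,v_h\rangle-\widetilde\lambda_h(v_h,v_h)\ge0\qquad\forall v_h\in V_h .$$ -/

import Mathlib

open MeasureTheory Filter Set
open scoped Topology ContDiff Matrix

noncomputable section

namespace WG

/-- The Euclidean plane `ℝ²`. -/
abbrev Plane := EuclideanSpace ℝ (Fin 2)

/-! ### Sobolev spaces on `Ω` -/

/-- `φ ∈ C_c^∞(Ω)`. -/
def IsTestFunction (Ω : Set Plane) (φ : Plane → ℝ) : Prop :=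
  ContDiff ℝ ∞ φ ∧ HasCompactSupport φ ∧ tsupport φ ⊆ Ω

/-- `G` is the distributional gradient of `u` in `Ω`. -/
def HasWeakGradient (Ω : Set Plane) (u : Plane → ℝ) (G : Plane → Plane) : Prop :=
  ∀ φ : Plane → ℝ, IsTestFunction Ω φ → ∀ i : Fin 2,
    ∫ x in Ω, u x * (gradient φ x) i = - ∫ x in Ω, (G x) i * φ x

/-- `u ∈ H^1_0(Ω)`: the function `u` belongs to `H^1(Ω)` and is the limit, in the norm of
`H^1(Ω)`, of a sequence of functions in `C_c^∞(Ω)`. -/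
def MemH10 (Ω : Set Plane) (u : Plane → ℝ) : Prop :=
  MemLp u 2 (volume.restrict Ω) ∧
  ∃ G : Plane → Plane, MemLp G 2 (volume.restrict Ω) ∧ HasWeakGradient Ω u G ∧
    ∃ φ : ℕ → Plane → ℝ, (∀ n, IsTestFunction Ω (φ n)) ∧
      Tendsto (fun n => eLpNorm (fun x => u x - φ n x) 2 (volume.restrict Ω)) atTop (𝓝 0) ∧
      Tendsto (fun n => eLpNorm (fun x => G x - gradient (φ n) x) 2 (volume.restrict Ω))
        atTop (𝓝 0)

open Classical in
/-- The weak gradient in `L^2(Ω)` (unique up to null sets when it exists, and `0` otherwise). -/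
def weakGradient (Ω : Set Plane) (u : Plane → ℝ) : Plane → Plane :=
  if h : ∃ G : Plane → Plane, MemLp G 2 (volume.restrict Ω) ∧ HasWeakGradient Ω u G
  then h.choose else 0

/-! ### The continuous problem -/

/-- The diffusion matrix lies in `L^∞(Ω)^{2×2}` and is symmetric. -/
def IsDiffusionMatrix (Ω : Set Plane) (A : Plane → Matrix (Fin 2) (Fin 2) ℝ) : Prop :=
  (∀ i j, MemLp (fun x => A x i j) ⊤ (volume.restrict Ω)) ∧
  ∀ᵐ x ∂(volume.restrict Ω), (A x).IsSymm

/-- The potential lies in `L^2(Ω)` and is non-negative. -/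
def IsPotential (Ω : Set Plane) (V : Plane → ℝ) : Prop :=
  MemLp V 2 (volume.restrict Ω) ∧ ∀ᵐ x ∂(volume.restrict Ω), 0 ≤ V x

/-- (A1): uniform ellipticity. -/
def AssumptionA1 (Ω : Set Plane) (A : Plane → Matrix (Fin 2) (Fin 2) ℝ) : Prop :=
  ∃ α : ℝ, 0 < α ∧ ∀ᵐ x ∂(volume.restrict Ω), ∀ ξ : Fin 2 → ℝ,
    α * (ξ ⬝ᵥ ξ) ≤ ξ ⬝ᵥ (A x *ᵥ ξ)

/-- (A2): `F ∈ C^1[0,∞) ∩ C^2(0,∞)` and `inf_{t>0} F''(t) > 0`. -/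
def AssumptionA2 (F : ℝ → ℝ) : Prop :=
  ContDiffOn ℝ 1 F (Ici 0) ∧ ContDiffOn ℝ 2 F (Ioi 0) ∧
  ∃ c : ℝ, 0 < c ∧ ∀ t : ℝ, 0 < t → c ≤ deriv (deriv F) t

/-- `f = F'` on `[0,∞)` (one-sided derivative at `0`). -/
def nonlin (F : ℝ → ℝ) (t : ℝ) : ℝ := derivWithin F (Ici 0) t

/-- (A3): `|F'(t)| ≤ C (1 + t^q)` for all `t ≥ 0`, for some `q ∈ [0,2)`. -/
def AssumptionA3 (F : ℝ → ℝ) : Prop :=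
  ∃ q : ℝ, 0 ≤ q ∧ q < 2 ∧ ∃ C : ℝ, ∀ t : ℝ, 0 ≤ t → |nonlin F t| ≤ C * (1 + t ^ q)

/-- The energy `E(v) = ½ (A∇v, ∇v) + ½ (V v, v) + ½ ∫_Ω F(v²)`. -/
def energy (Ω : Set Plane) (A : Plane → Matrix (Fin 2) (Fin 2) ℝ) (V : Plane → ℝ)
    (F : ℝ → ℝ) (v : Plane → ℝ) : ℝ :=
  1 / 2 * ((∫ x in Ω, (A x *ᵥ (weakGradient Ω v x).ofLp) ⬝ᵥ (weakGradient Ω v x).ofLp) +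
      ∫ x in Ω, V x * v x * v x) +
    1 / 2 * ∫ x in Ω, F (v x ^ 2)

/-- `u` is a non-negative minimizer of `E` over `{v ∈ H^1_0(Ω) : ∫_Ω v² = 1}`. -/
def IsGroundState (Ω : Set Plane) (A : Plane → Matrix (Fin 2) (Fin 2) ℝ) (V : Plane → ℝ)
    (F : ℝ → ℝ) (u : Plane → ℝ) : Prop :=
  MemH10 Ω u ∧ (∫ x in Ω, u x ^ 2) = 1 ∧ (∀ᵐ x ∂(volume.restrict Ω), 0 ≤ u x) ∧
  ∀ v : Plane → ℝ, MemH10 Ω v → (∫ x in Ω, v x ^ 2) = 1 →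
    energy Ω A V F u ≤ energy Ω A V F v

/-! ### Polygonal meshes -/

/-- The unit normal of the directed segment from `a` to `b`, pointing to its right. -/
def rightNormal (a b : Plane) : Plane :=
  (dist a b)⁻¹ • !₂[b 1 - a 1, -(b 0 - a 0)]

/-- A simple polygon, with vertices in counterclockwise order. The vertex following number `i`
is number `finRotate n i`; straight angles are allowed. The set `carrier` is the open
region bounded by the polygonal curve: it is open, connected, bounded, its boundary
is the curve, and it lies to the left of each directed edge. -/
structure Polygon where
  n : ℕ
  three_le : 3 ≤ n
  vertex : Fin n → Plane
  vertex_injective : Function.Injective vertex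
  edges_disjoint : ∀ i j, i ≠ j →
    Disjoint (openSegment ℝ (vertex i) (vertex (finRotate n i)))
      (segment ℝ (vertex j) (vertex (finRotate n j)))
  carrier : Set Plane
  isOpen_carrier : IsOpen carrier
  isConnected_carrier : IsConnected carrier
  isBounded_carrier : Bornology.IsBounded carrier
  frontier_carrier : frontier carrier = ⋃ i, segment ℝ (vertex i) (vertex (finRotate n i))
  counterclockwise : ∀ i, ∀ x ∈ openSegment ℝ (vertex i) (vertex (finRotate n i)),
    ∀ᶠ t : ℝ in 𝓝[>] 0, x - t • rightNormal (vertex i) (vertex (finRotate n i)) ∈ carrier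

namespace Polygon

/-- The closed `i`-th edge. -/
def edge (T : Polygon) (i : Fin T.n) : Set Plane :=
  segment ℝ (T.vertex i) (T.vertex (finRotate T.n i))

/-- The `i`-th edge without its endpoints. -/
def openEdge (T : Polygon) (i : Fin T.n) : Set Plane :=
  openSegment ℝ (T.vertex i) (T.vertex (finRotate T.n i))

/-- The outward unit normal on the `i`-th edge. -/
def normal (T : Polygon) (i : Fin T.n) : Plane :=
  rightNormal (T.vertex i) (T.vertex (finRotate T.n i))

/-- The diameter `h_T`. -/
def diam (T : Polygon) : ℝ := Metric.diam T.carrier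

/-- The integral of `g` over the `i`-th edge with respect to arc length. -/
def edgeIntegral (T : Polygon) (i : Fin T.n) (g : Plane → ℝ) : ℝ :=
  dist (T.vertex i) (T.vertex (finRotate T.n i)) *
    ∫ t in (0 : ℝ)..1, g (AffineMap.lineMap (T.vertex i) (T.vertex (finRotate T.n i)) t)

end Polygon

/-- A finite partition of `Ω` into polygons, two of which share an edge or meet in vertices
only (a hanging node counts as a vertex of every element it lies on). -/
structure Mesh (Ω : Set Plane) where
  N : ℕ
  elem : Fin N → Polygon
  disjoint : ∀ K L, K ≠ L → Disjoint (elem K).carrier (elem L).carrier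
  cover : ⋃ K, closure (elem K).carrier = closure Ω
  conforming : ∀ K L, ∀ (i : Fin (elem K).n) (j : Fin (elem L).n),
    (elem K).edge i = (elem L).edge j ∨ Disjoint ((elem K).openEdge i) ((elem L).edge j)

/-- The set `𝓔_h` of edges of the mesh, as a type; an edge shared by two elements occurs once. -/
abbrev Mesh.Edge {Ω : Set Plane} (M : Mesh Ω) : Type :=
  {e : Set Plane // ∃ (K : Fin M.N) (i : Fin (M.elem K).n), e = (M.elem K).edge i}

/-- The `i`-th edge of the element `K`, as an edge of the mesh. -/
def Mesh.edgeOf {Ω : Set Plane} (M : Mesh Ω) (K : Fin M.N) (i : Fin (M.elem K).n) : M.Edge :=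
  ⟨(M.elem K).edge i, K, i, rfl⟩

/-! ### Polynomial spaces -/

/-- The space of bivariate polynomials of total degree at most `m`. It serves as `P_m(T)` for the
elements `T`, on which (they have interior points) a polynomial is determined by its values. -/
abbrev Poly (m : ℕ) : Submodule ℝ (MvPolynomial (Fin 2) ℝ) :=
  MvPolynomial.restrictTotalDegree (Fin 2) ℝ m

/-- The value of the polynomial `p` at the point `x`. -/
def pval (p : MvPolynomial (Fin 2) ℝ) (x : Plane) : ℝ := MvPolynomial.eval x.ofLp p

/-- Restriction of a polynomial to `S`, as a function on the plane that vanishes off `S`. -/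
def restrictTo (S : Set Plane) : MvPolynomial (Fin 2) ℝ →ₗ[ℝ] (Plane → ℝ) where
  toFun p := S.indicator (pval p)
  map_add' p q := by
    funext x; by_cases hx : x ∈ S <;> simp [hx, pval]
  map_smul' c p := by
    funext x; by_cases hx : x ∈ S <;> simp [hx, pval]

/-- `P_m(e)`: the restrictions to `e` of polynomials of degree at most `m`, where a function on
`e` is represented by its extension by zero. -/
def polyOn (e : Set Plane) (m : ℕ) : Submodule ℝ (Plane → ℝ) := (Poly m).map (restrictTo e)

open Classical in
/-- The element `p` of `W` with `B p q = L q` for all `q ∈ W`. It is used only where `B` is an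
`L^2` inner product on a finite-dimensional space `W` and `L` is linear, so that there is
exactly one. -/
def riesz {W : Type} [Zero W] (B : W → W → ℝ) (L : W → ℝ) : W :=
  if h : ∃ p, ∀ q, B p q = L q then h.choose else 0

/-- The `L^2(e)`-orthogonal projection `Q_b g` of `g` onto `P_m(e)`, `e` the `i`-th edge of `T`. -/
def projEdge (m : ℕ) (T : Polygon) (i : Fin T.n) (g : Plane → ℝ) : polyOn (T.edge i) m :=
  riesz (fun p q => T.edgeIntegral i (fun x => p.1 x * q.1 x))
    (fun q => T.edgeIntegral i (fun x => g x * q.1 x))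

/-! ### The weak Galerkin space and forms -/

section Space

variable {Ω : Set Plane}

/-- The weak Galerkin space `V_h` of degree `k`: pairs `(v₀, v_b)` with `v₀|_T ∈ P_k(T)` for each
element `T`, `v_b|_e ∈ P_{k-1}(e)` for each edge `e`, and `v_b = 0` on `∂Ω`. -/
def Vh (M : Mesh Ω) (k : ℕ) :
    Submodule ℝ ((Fin M.N → Poly k) × ((e : M.Edge) → polyOn e.1 (k - 1))) where
  carrier := {v | ∀ e : M.Edge, e.1 ⊆ frontier Ω → v.2 e = 0}
  add_mem' := by
    intro v w hv hw e he
    simp [hv e he, hw e he]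
  zero_mem' := by
    intro e _
    rfl
  smul_mem' := by
    intro c v hv e he
    simp [hv e he]

variable {M : Mesh Ω} {k : ℕ}

/-- The polynomial function `v₀|_K`. -/
def interiorPart (v : Vh M k) (K : Fin M.N) (x : Plane) : ℝ := pval (v.1.1 K).1 x

/-- The function `v_b` on the `i`-th edge of `K`. -/
def edgePart (v : Vh M k) (K : Fin M.N) (i : Fin (M.elem K).n) (x : Plane) : ℝ :=
  (v.1.2 (M.edgeOf K i)).1 x

/-- The discrete weak gradient `∇_w v` on the element `K`: the unique `G ∈ [P_{k-1}(K)]²` with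
`(G, q)_K = -(v₀, ∇·q)_K + ⟨v_b, q·n⟩_{∂K}` for all `q ∈ [P_{k-1}(K)]²`. -/
def wgrad (v : Vh M k) (K : Fin M.N) : Fin 2 → Poly (k - 1) :=
  riesz
    (fun G q => ∫ x in (M.elem K).carrier, ∑ l, pval (G l).1 x * pval (q l).1 x)
    (fun q =>
      -(∫ x in (M.elem K).carrier,
          interiorPart v K x * pval (∑ l, MvPolynomial.pderiv l (q l).1) x) +
        ∑ i, (M.elem K).edgeIntegral i
          (fun x => edgePart v K i x * ∑ l, pval (q l).1 x * ((M.elem K).normal i) l))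

/-- The `L^2(Ω)` inner product `(v_h, w_h) = ∑_K ∫_K v₀ w₀`. -/
def massForm (v w : Vh M k) : ℝ :=
  ∑ K, ∫ x in (M.elem K).carrier, interiorPart v K x * interiorPart w K x

/-- The stabilizer
`s(v_h, w_h) = ∑_K h_K^{-1+ε} ⟨Q_b v₀ - v_b, Q_b w₀ - w_b⟩_{∂K}`. -/
def stab (ε : ℝ) (v w : Vh M k) : ℝ :=
  ∑ K, (M.elem K).diam ^ (-1 + ε) *
    ∑ i, (M.elem K).edgeIntegral i (fun x =>
      ((projEdge (k - 1) (M.elem K) i (interiorPart v K)).1 x - edgePart v K i x) *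
      ((projEdge (k - 1) (M.elem K) i (interiorPart w K)).1 x - edgePart w K i x))

/-- `a_h(v_h, w_h) = (A ∇_w v_h, ∇_w w_h) + (V v_h, w_h) + s(v_h, w_h)`. -/
def ah (ε : ℝ) (A : Plane → Matrix (Fin 2) (Fin 2) ℝ) (V : Plane → ℝ) (v w : Vh M k) : ℝ :=
  (∑ K, ∫ x in (M.elem K).carrier,
      (A x *ᵥ (fun l => pval (wgrad v K l).1 x)) ⬝ᵥ (fun l => pval (wgrad w K l).1 x)) +
    (∑ K, ∫ x in (M.elem K).carrier, V x * interiorPart v K x * interiorPart w K x) +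
    stab ε v w

/-- `⟨A_h^u v_h, w_h⟩ = a_h(v_h, w_h) + (f(u²) v_h, w_h)`, where `f = F'`. -/
def Ahu (ε : ℝ) (A : Plane → Matrix (Fin 2) (Fin 2) ℝ) (V : Plane → ℝ) (F : ℝ → ℝ)
    (u : Plane → ℝ) (v w : Vh M k) : ℝ :=
  ah ε A V v w +
    ∑ K, ∫ x in (M.elem K).carrier, nonlin F (u x ^ 2) * interiorPart v K x * interiorPart w K x

/-- `(w, μ)` is an eigenpair: `w ≠ 0` and `⟨A_h^u w, v_h⟩ = μ (w, v_h)` for all `v_h ∈ V_h`. -/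
def IsEigenpair (ε : ℝ) (A : Plane → Matrix (Fin 2) (Fin 2) ℝ) (V : Plane → ℝ) (F : ℝ → ℝ)
    (u : Plane → ℝ) (w : Vh M k) (μ : ℝ) : Prop :=
  w ≠ 0 ∧ ∀ v : Vh M k, Ahu ε A V F u w v = μ * massForm w v

/-- `(w, μ)` is a first eigenpair: an eigenpair whose eigenvalue is the smallest one. -/
def IsFirstEigenpair (ε : ℝ) (A : Plane → Matrix (Fin 2) (Fin 2) ℝ) (V : Plane → ℝ)
    (F : ℝ → ℝ) (u : Plane → ℝ) (w : Vh M k) (μ : ℝ) : Prop :=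
  IsEigenpair ε A V F u w μ ∧
  ∀ (w' : Vh M k) (μ' : ℝ), IsEigenpair ε A V F u w' μ' → μ ≤ μ'

end Space

end WG

end

noncomputable section

namespace WG


/-! ### Generalized symmetric eigenvalue problems with a semidefinite mass form -/

/-! The claim is the Rayleigh principle for the pencil B w = μ m w on the finite-dimensional space
V_h, with B the form of A_h^u and m the mass form. The difficulty is that m sees only v₀ and is
merely semidefinite. What saves the argument is `Ahu_self_pos`: on the kernel of m the potential and
nonlinear terms vanish, ellipticity keeps the gradient term non-negative, and the stabilizer
controls v_b, so B is positive there.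

By compactness B + n m is then positive definite for some n. A maximizer w of m / (B + n m), with
maximum κ > 0, is an eigenvector for μ = 1/κ - n, and maximality says μ m(v,v) ≤ B(v,v) for all v
(`exists_eigenpair_le`). The given eigenvalue is at most μ and m is non-negative, which gives the
claim. That m is not identically zero follows from the given eigenvector.

To apply this, the forms must be bilinear although Q_b and ∇_w are defined by choice (`riesz_spec`
removes the choice), and the coefficients must be integrable on the elements. For f(u²) this comes
from H¹₀ ⊂ L⁴ and the growth bound (`MemH10.memLp_four`, `integrableOn_nonlin`). -/

theorem apply_eq_zero_of_apply_self_eq_zero {W : Type*} [AddCommGroup W] [Module ℝ W]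
    (P : W →ₗ[ℝ] W →ₗ[ℝ] ℝ) (hsymm : ∀ v w, P v w = P w v) (hP : ∀ v, 0 ≤ P v v)
    {w : W} (hw : P w w = 0) (v : W) : P w v = 0 := by
  by_contra hne
  -- As P w w = 0, the form is affine in t along v + t w; this t makes its value -1.
  have h := hP (v + (-(P v v + 1) / (2 * P w v)) • w)
  simp only [map_add, map_smul, LinearMap.add_apply, LinearMap.smul_apply, smul_eq_mul, hw,
    hsymm v w] at h
  have : -(P v v + 1) / (2 * P w v) * P w v = -(P v v + 1) / 2 := by field_simp
  rw [this] at h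
  linarith

theorem continuous_apply_self {W : Type*} [NormedAddCommGroup W] [NormedSpace ℝ W]
    [FiniteDimensional ℝ W] (P : W →ₗ[ℝ] W →ₗ[ℝ] ℝ) : Continuous fun v => P v v := by
  let P' : W →ₗ[ℝ] W →L[ℝ] ℝ :=
    (LinearMap.toContinuousLinearMap : (W →ₗ[ℝ] ℝ) ≃ₗ[ℝ] (W →L[ℝ] ℝ)).toLinearMap ∘ₗ P
  have h : Continuous P' := P'.continuous_of_finiteDimensional
  exact h.clm_apply continuous_id

theorem exists_eigenpair_le_of_normed {W : Type*} [NormedAddCommGroup W] [NormedSpace ℝ W]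
    [FiniteDimensional ℝ W] (B m : W →ₗ[ℝ] W →ₗ[ℝ] ℝ)
    (hB : ∀ v w, B v w = B w v) (hm : ∀ v w, m v w = m w v) (hm0 : ∀ v, 0 ≤ m v v)
    (hpos : ∀ v, m v v = 0 → v ≠ 0 → 0 < B v v) (hne : ∃ v, m v v ≠ 0) :
    ∃ w : W, ∃ μ : ℝ, w ≠ 0 ∧ (∀ v, B w v = μ * m w v) ∧ ∀ v, μ * m v v ≤ B v v := by
  have hproper : ProperSpace W := FiniteDimensional.proper_real W
  have hK : IsCompact (Metric.sphere (0 : W) 1) := isCompact_sphere 0 1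
  have hnz : ∀ v ∈ Metric.sphere (0 : W) 1, v ≠ 0 := fun v hv h => by simp [h] at hv
  have hBc := continuous_apply_self B
  have hmc := continuous_apply_self m
  -- These open sets increase with n because m is non-negative, so a single one covers the sphere.
  obtain ⟨n, hn⟩ := hK.elim_directed_cover (fun n : ℕ => {v : W | 0 < B v v + n * m v v})
    (fun n => isOpen_lt continuous_const (hBc.add (continuous_const.mul hmc)))
    (by
      intro v hv
      rw [mem_iUnion]
      rcases (hm0 v).eq_or_lt with h | h
      · exact ⟨0, by simpa using hpos v h.symm (hnz v hv)⟩
      · obtain ⟨n, hn⟩ := exists_nat_gt (-(B v v) / m v v)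
        rw [div_lt_iff₀ h] at hn
        exact ⟨n, by simp only [mem_ofPred_eq]; linarith⟩)
    (directed_of_isDirected_le (fun i j hij v hv => by
      simp only [mem_ofPred_eq] at hv ⊢
      have : (i : ℝ) * m v v ≤ j * m v v :=
        mul_le_mul_of_nonneg_right (by exact_mod_cast hij) (hm0 v)
      linarith))
  set D : W →ₗ[ℝ] W →ₗ[ℝ] ℝ := B + (n : ℝ) • m with hD
  have hDapp : ∀ v w, D v w = B v w + n * m v w := fun v w => by simp [hD]
  have hDpos : ∀ v ∈ Metric.sphere (0 : W) 1, 0 < D v v := fun v hv => by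
    rw [hDapp]; exact hn hv
  obtain ⟨v₀, hv₀⟩ := hne
  have hv₀' : v₀ ≠ 0 := by rintro rfl; simp at hv₀
  have hscale : ∀ v : W, v ≠ 0 → ‖v‖⁻¹ • v ∈ Metric.sphere (0 : W) 1 := fun v hv => by
    simp [norm_smul, hv]
  -- The quotient is m / D rather than B / m, since m may vanish on the sphere.
  obtain ⟨w, hw, hmax⟩ := hK.exists_isMaxOn ⟨_, hscale v₀ hv₀'⟩
    (f := fun v => m v v / D v v)
    (hmc.continuousOn.div (continuous_apply_self D).continuousOn fun v hv => (hDpos v hv).ne')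
  set κ := m w w / D w w with hκ
  have hle : ∀ v, 0 ≤ κ * D v v - m v v := by
    intro v
    by_cases hv : v = 0
    · simp [hv]
    have h1 := hmax (hscale v hv)
    have h2 := hDpos _ (hscale v hv)
    simp only [mem_ofPred_eq] at h1
    rw [div_le_iff₀ h2] at h1
    simp only [map_smul, LinearMap.smul_apply, smul_eq_mul] at h1
    have h3 : 0 < ‖v‖⁻¹ := inv_pos.2 (norm_pos_iff.2 hv)
    by_contra hcon
    push Not at hcon
    have h4 := mul_pos (mul_pos h3 h3) (neg_pos.2 hcon)
    nlinarith
  have hκpos : 0 < κ := by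
    have h1 := hle v₀
    have h2 : 0 < m v₀ v₀ := lt_of_le_of_ne (hm0 v₀) hv₀.symm
    have h3 : 0 ≤ κ := div_nonneg (hm0 w) (hDpos w hw).le
    rcases h3.eq_or_lt with h | h
    · rw [← h] at h1; linarith
    · exact h
  -- The semidefinite form κ D - m vanishes at w, so w lies in its kernel; this replaces
  -- differentiating the quotient.
  have hw0 : ∀ v, κ * D w v - m w v = 0 := by
    intro v
    have := apply_eq_zero_of_apply_self_eq_zero (κ • D - m)
      (fun v w => by simp [hDapp, hB v w, hm v w]) (fun v => by simpa using hle v)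
      (w := w) (by
        simp only [LinearMap.sub_apply, LinearMap.smul_apply, smul_eq_mul, hκ]
        rw [div_mul_cancel₀ _ (hDpos w hw).ne', sub_self]) v
    simpa using this
  refine ⟨w, κ⁻¹ - n, hnz w hw, fun v => ?_, fun v => ?_⟩
  · have h := hw0 v
    rw [hDapp] at h
    have : m w v = κ * (B w v + n * m w v) := by linarith
    have h' : κ⁻¹ * m w v = B w v + n * m w v := by
      rw [inv_mul_eq_iff_eq_mul₀ hκpos.ne']; exact this
    linarith
  · have h := hle v
    rw [hDapp] at h
    have h' : κ⁻¹ * m v v ≤ B v v + n * m v v := by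
      rw [inv_mul_le_iff₀ hκpos]; linarith
    linarith

/-- The smallest eigenvalue of `B w = μ m w` exists and bounds the Rayleigh quotient from below. -/
theorem exists_eigenpair_le {W : Type*} [AddCommMonoid W] [Module ℝ W]
    [Module.Finite ℝ W] (B m : W →ₗ[ℝ] W →ₗ[ℝ] ℝ)
    (hB : ∀ v w, B v w = B w v) (hm : ∀ v w, m v w = m w v) (hm0 : ∀ v, 0 ≤ m v v)
    (hpos : ∀ v, m v v = 0 → v ≠ 0 → 0 < B v v) (hne : ∃ v, m v v ≠ 0) :
    ∃ w : W, ∃ μ : ℝ, w ≠ 0 ∧ (∀ v, B w v = μ * m w v) ∧ ∀ v, μ * m v v ≤ B v v := by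
  let _ : AddCommGroup W := Module.addCommMonoidToAddCommGroup ℝ
  -- Coordinates supply the norm that the compactness argument needs.
  let e := (Module.finBasis ℝ W).equivFun
  obtain ⟨w, μ, hw, h1, h2⟩ := exists_eigenpair_le_of_normed
    (B.compl₁₂ e.symm.toLinearMap e.symm.toLinearMap)
    (m.compl₁₂ e.symm.toLinearMap e.symm.toLinearMap)
    (fun v w => hB _ _) (fun v w => hm _ _) (fun v => hm0 _)
    (fun v hv hv' => hpos _ hv (by simpa using hv'))
    (by obtain ⟨v, hv⟩ := hne; exact ⟨e v, by simpa using hv⟩)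
  refine ⟨e.symm w, μ, by simpa using hw, fun v => ?_, fun v => ?_⟩
  · simpa using h1 (e v)
  · simpa using h2 (e v)

/-! ### Riesz representation -/

/-- Definiteness makes B injective into the dual, which has the same dimension, so a representative
exists and the fallback value 0 in `riesz` is never taken. -/
theorem riesz_spec {W : Type} [AddCommGroup W] [Module ℝ W] [FiniteDimensional ℝ W]
    (B : W →ₗ[ℝ] W →ₗ[ℝ] ℝ) (hB : ∀ p, B p p = 0 → p = 0) (L : W →ₗ[ℝ] ℝ) (q : W) :
    B (riesz (fun p q => B p q) (fun q => L q)) q = L q := by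
  have hinj : Function.Injective B := by
    rw [injective_iff_map_eq_zero]
    intro p hp
    exact hB p (by rw [hp]; rfl)
  obtain ⟨p, hp⟩ := (LinearMap.injective_iff_surjective_of_finrank_eq_finrank
    (Subspace.dual_finrank_eq (K := ℝ) (V := W)).symm).1 hinj L
  have h : ∃ p, ∀ q, (fun p q => B p q) p q = (fun q => L q) q := ⟨p, fun q => by simp [hp]⟩
  rw [riesz, dif_pos h]
  exact h.choose_spec q

/-! ### The Sobolev embedding `H^1_0(Ω) ⊆ L^4(Ω)` -/

theorem norm_gradient_eq (φ : Plane → ℝ) (x : Plane) : ‖gradient φ x‖ = ‖fderiv ℝ φ x‖ := by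
  rw [← toDual_gradient, LinearIsometryEquiv.norm_map]

/-- Gagliardo–Nirenberg–Sobolev in dimension 2: the exponent 4/3 is the one whose critical exponent
is 4, as 3/4 - 1/2 = 1/4. -/
theorem exists_eLpNorm_four_le_fderiv {Ω : Set Plane} (hΩ : Bornology.IsBounded Ω) :
    ∃ c : NNReal, ∀ φ : Plane → ℝ, ContDiff ℝ 1 φ → Function.support φ ⊆ Ω →
      eLpNorm φ 4 volume ≤ c * eLpNorm (fderiv ℝ φ) ((4 / 3 : NNReal) : ENNReal) volume := by
  refine ⟨eLpNormLESNormFDerivOfLeConst ℝ (volume : Measure Plane) Ω (4 / 3) 4, fun φ hφ hs => ?_⟩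
  exact eLpNorm_le_eLpNorm_fderiv_of_le (volume : Measure Plane) hφ hs (p := 4 / 3) (q := 4)
    (by rw [← NNReal.coe_le_coe]; norm_num) (by
      rw [← NNReal.coe_lt_coe]; simp; norm_num) (by simp; norm_num) hΩ

/-- Hölder's inequality on the bounded set Ω raises the gradient exponent from 4/3 to 2. -/
theorem IsTestFunction.eLpNorm_four_le {Ω : Set Plane} (hΩ : Bornology.IsBounded Ω) :
    ∃ C : ENNReal, C ≠ ⊤ ∧ ∀ φ, IsTestFunction Ω φ →
      eLpNorm φ 4 (volume.restrict Ω) ≤ C * eLpNorm (gradient φ) 2 (volume.restrict Ω) := by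
  obtain ⟨c, hc⟩ := exists_eLpNorm_four_le_fderiv hΩ
  have hfin : volume Ω ≠ ⊤ := hΩ.measure_lt_top.ne
  have hr : ((4 / 3 : NNReal) : ENNReal).toReal = 4 / 3 := by
    rw [ENNReal.coe_toReal]; norm_num
  have hr2 : ((4 / 3 : NNReal) : ENNReal) ≤ 2 := by
    have : (4 / 3 : NNReal) ≤ 2 := by rw [← NNReal.coe_le_coe]; norm_num
    exact_mod_cast this
  generalize ((4 / 3 : NNReal) : ENNReal) = r at hc hr hr2
  refine ⟨c * volume Ω ^ (1 / r.toReal - 1 / (2 : ENNReal).toReal), ?_, ?_⟩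
  · refine ENNReal.mul_ne_top ENNReal.coe_ne_top (ENNReal.rpow_ne_top_of_nonneg ?_ hfin)
    rw [hr, ENNReal.toReal_ofNat]; norm_num
  rintro φ ⟨hφ, -, hs⟩
  have hφ1 : ContDiff ℝ 1 φ := hφ.of_le (by exact_mod_cast le_top)
  have key := hc φ hφ1 ((subset_tsupport φ).trans hs)
  rw [← eLpNorm_restrict_eq_of_support_subset (f := fderiv ℝ φ)
    ((support_fderiv_subset ℝ).trans hs)] at key
  have hle := eLpNorm_le_eLpNorm_mul_rpow_measure_univ (μ := volume.restrict Ω) hr2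
    (hφ1.continuous_fderiv (by simp)).aestronglyMeasurable
  rw [Measure.restrict_apply_univ, eLpNorm_congr_norm_ae (p := 2) (g := gradient φ)
    (Eventually.of_forall fun x => (norm_gradient_eq φ x).symm)] at hle
  calc eLpNorm φ 4 (volume.restrict Ω) ≤ eLpNorm φ 4 volume :=
        eLpNorm_mono_measure _ Measure.restrict_le_self
    _ ≤ _ := key
    _ ≤ _ := mul_le_mul_right hle _
    _ = _ := by ring

/-- The approximating test functions have L²-convergent gradients, hence are eventually bounded in
L⁴; Fatou's lemma along an a.e. convergent subsequence passes the bound to u. -/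
theorem MemH10.memLp_four {Ω : Set Plane} (hΩ : Bornology.IsBounded Ω) {u : Plane → ℝ}
    (hu : MemH10 Ω u) : MemLp u 4 (volume.restrict Ω) := by
  obtain ⟨hu2, G, hG, -, φ, hφ, hlim, hgrad⟩ := hu
  obtain ⟨C, hC, hCφ⟩ := IsTestFunction.eLpNorm_four_le hΩ
  have hφm : ∀ n, AEStronglyMeasurable (φ n) (volume.restrict Ω) := fun n =>
    (hφ n).1.continuous.aestronglyMeasurable
  have hgm : ∀ n, AEStronglyMeasurable (gradient (φ n)) (volume.restrict Ω) := fun n =>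
    ((InnerProductSpace.toDual ℝ Plane).symm.continuous.comp
      ((hφ n).1.continuous_fderiv (by simp))).aestronglyMeasurable
  have hmeas := tendstoInMeasure_of_tendsto_eLpNorm (p := 2) (by simp) hφm hu2.1
    (by
      refine hlim.congr fun n => ?_
      rw [← eLpNorm_neg]
      congr 1
      ext x; simp)
  obtain ⟨ns, hns, hae⟩ := hmeas.exists_seq_tendsto_ae
  refine ⟨hu2.1, ?_⟩
  have hF := Lp.eLpNorm_lim_le_liminf_eLpNorm (p := 4) (fun n => hφm (ns n)) u hae
  refine hF.trans_lt ?_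
  have hb : ∀ᶠ n in atTop, eLpNorm (φ (ns n)) 4 (volume.restrict Ω) ≤
      C * (eLpNorm G 2 (volume.restrict Ω) + 1) := by
    have h1 := (hgrad.comp hns.tendsto_atTop).eventually (gt_mem_nhds (zero_lt_one))
    filter_upwards [h1] with n hn
    refine (hCφ _ (hφ _)).trans ?_
    gcongr
    have : gradient (φ (ns n)) = G - (fun x => G x - gradient (φ (ns n)) x) := by
      ext x; simp
    rw [this]
    refine (eLpNorm_sub_le hG.1 (hG.1.sub (hgm _)) (by norm_num)).trans ?_
    gcongr
    exact hn.le
  refine (liminf_le_of_frequently_le' hb.frequently).trans_lt ?_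
  exact ENNReal.mul_lt_top hC.lt_top (ENNReal.add_lt_top.2 ⟨hG.2, ENNReal.one_lt_top⟩)


/-! ### Values of polynomials -/

theorem continuous_pval (p : MvPolynomial (Fin 2) ℝ) : Continuous (pval p) :=
  (MvPolynomial.continuous_eval p).comp (PiLp.continuous_ofLp 2 _)

theorem pval_add (p q : MvPolynomial (Fin 2) ℝ) (x : Plane) :
    pval (p + q) x = pval p x + pval q x := by simp [pval]

theorem pval_smul (c : ℝ) (p : MvPolynomial (Fin 2) ℝ) (x : Plane) :
    pval (c • p) x = c * pval p x := by simp [pval]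

theorem pval_mul (p q : MvPolynomial (Fin 2) ℝ) (x : Plane) :
    pval (p * q) x = pval p x * pval q x := by simp [pval]

theorem pval_zero (x : Plane) : pval 0 x = 0 := by simp [pval]

/-- An open set contains a box, a product of infinite sets, and a polynomial vanishing on such a
product is zero. -/
theorem eq_zero_of_pval_eq_zero {U : Set Plane} (hU : IsOpen U) (hne : U.Nonempty)
    {p : MvPolynomial (Fin 2) ℝ} (hp : ∀ x ∈ U, pval p x = 0) : p = 0 := by
  obtain ⟨x₀, hx₀⟩ := hne
  have hU' : IsOpen {y : Fin 2 → ℝ | WithLp.toLp 2 y ∈ U} :=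
    hU.preimage (PiLp.continuous_toLp 2 _)
  obtain ⟨δ, hδ, hball⟩ := Metric.isOpen_iff.1 hU' x₀.ofLp hx₀
  rw [ball_pi _ hδ] at hball
  refine MvPolynomial.funext_set (fun i => Metric.ball (x₀.ofLp i) δ) (fun i => ?_) fun x hx => ?_
  · rw [Real.ball_eq_Ioo]
    exact Ioo_infinite (by linarith)
  · simpa [pval] using hp _ (hball hx)

/-! ### Integrals of polynomials over elements -/

theorem integrableOn_mul_of_continuous {S : Set Plane} (hb : Bornology.IsBounded S)
    (ho : IsOpen S) {g h : Plane → ℝ} (hg : IntegrableOn g S) (hh : Continuous h) :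
    IntegrableOn (fun x => g x * h x) S :=
  hg.mul_continuousOn_of_subset hh.continuousOn ho.measurableSet hb.isCompact_closure
    subset_closure

theorem integrableOn_const_one {S : Set Plane} (hb : Bornology.IsBounded S) :
    IntegrableOn (fun _ => (1 : ℝ)) S :=
  integrableOn_const hb.measure_lt_top.ne

theorem integrableOn_of_continuous {S : Set Plane} (hb : Bornology.IsBounded S)
    (ho : IsOpen S) {h : Plane → ℝ} (hh : Continuous h) : IntegrableOn h S := by
  simpa using integrableOn_mul_of_continuous hb ho (integrableOn_const_one hb) hh

theorem eqOn_zero_of_setIntegral_eq_zero {S : Set Plane} (hb : Bornology.IsBounded S)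
    (ho : IsOpen S) {h : Plane → ℝ} (hh : Continuous h) (h0 : ∀ x, 0 ≤ h x)
    (hint : ∫ x in S, h x = 0) : ∀ x ∈ S, h x = 0 := by
  rw [setIntegral_eq_zero_iff_of_nonneg_ae (Eventually.of_forall h0)
    (integrableOn_of_continuous hb ho hh)] at hint
  exact Measure.eqOn_open_of_ae_eq hint ho hh.continuousOn continuousOn_const

/-- The linear functional `p ↦ ∫_S g p` on polynomials. -/
def moment {S : Set Plane} (hb : Bornology.IsBounded S) (ho : IsOpen S) {g : Plane → ℝ}
    (hg : IntegrableOn g S) : MvPolynomial (Fin 2) ℝ →ₗ[ℝ] ℝ where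
  toFun p := ∫ x in S, g x * pval p x
  map_add' p q := by
    rw [← integral_add (integrableOn_mul_of_continuous hb ho hg (continuous_pval p))
      (integrableOn_mul_of_continuous hb ho hg (continuous_pval q))]
    simp only [pval_add, mul_add]
  map_smul' c p := by
    simp only [pval_smul, RingHom.id_apply, smul_eq_mul]
    rw [← integral_const_mul]
    congr 1; ext x; ring

/-- The bilinear form `(p, q) ↦ ∫_S g p q` on polynomials. -/
def weightedForm {S : Set Plane} (hb : Bornology.IsBounded S) (ho : IsOpen S) {g : Plane → ℝ}
    (hg : IntegrableOn g S) :
    MvPolynomial (Fin 2) ℝ →ₗ[ℝ] MvPolynomial (Fin 2) ℝ →ₗ[ℝ] ℝ :=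
  (LinearMap.mul ℝ (MvPolynomial (Fin 2) ℝ)).compr₂ (moment hb ho hg)

theorem weightedForm_apply {S : Set Plane} (hb : Bornology.IsBounded S) (ho : IsOpen S)
    {g : Plane → ℝ} (hg : IntegrableOn g S) (p q : MvPolynomial (Fin 2) ℝ) :
    weightedForm hb ho hg p q = ∫ x in S, g x * pval p x * pval q x := by
  simp [weightedForm, moment, pval_mul, mul_assoc]

/-- The bilinear form `(G, H) ↦ ∫_S (A G) · H` on pairs of polynomials. -/
def matrixForm {S : Set Plane} (hb : Bornology.IsBounded S) (ho : IsOpen S)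
    {A : Plane → Matrix (Fin 2) (Fin 2) ℝ} (hA : ∀ i j, IntegrableOn (fun x => A x i j) S)
    (m : ℕ) : (Fin 2 → Poly m) →ₗ[ℝ] (Fin 2 → Poly m) →ₗ[ℝ] ℝ :=
  ∑ i, ∑ j, (weightedForm hb ho (hA i j)).compl₁₂ ((Poly m).subtype ∘ₗ LinearMap.proj j)
    ((Poly m).subtype ∘ₗ LinearMap.proj i)

theorem matrixForm_apply {S : Set Plane} (hb : Bornology.IsBounded S) (ho : IsOpen S)
    {A : Plane → Matrix (Fin 2) (Fin 2) ℝ} (hA : ∀ i j, IntegrableOn (fun x => A x i j) S)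
    {m : ℕ} (G H : Fin 2 → Poly m) :
    matrixForm hb ho hA m G H =
      ∫ x in S, (A x *ᵥ (fun l => pval (G l).1 x)) ⬝ᵥ (fun l => pval (H l).1 x) := by
  have hint : ∀ i j, IntegrableOn (fun x => A x i j * pval (G j).1 x * pval (H i).1 x) S :=
    fun i j => integrableOn_mul_of_continuous hb ho
      (integrableOn_mul_of_continuous hb ho (hA i j) (continuous_pval _)) (continuous_pval _)
  simp only [matrixForm, LinearMap.sum_apply, LinearMap.compl₁₂_apply, weightedForm_apply,
    dotProduct, Matrix.mulVec, Finset.sum_mul, LinearMap.comp_apply, LinearMap.proj_apply,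
    Submodule.subtype_apply]
  rw [integral_finsetSum _ fun i _ => integrable_finsetSum _ fun j _ => hint i j]
  refine Finset.sum_congr rfl fun i _ => ?_
  rw [integral_finsetSum _ fun j _ => hint i j]

/-! ### Integrals over edges -/

namespace Polygon

variable (T : Polygon) (i : Fin T.n)

theorem dist_pos : 0 < dist (T.vertex i) (T.vertex (finRotate T.n i)) := by
  rw [_root_.dist_pos]
  intro h
  have h1 := T.vertex_injective h
  obtain ⟨n, hn⟩ : ∃ n, T.n = n + 2 := ⟨T.n - 2, by have := T.three_le; omega⟩
  -- The index type depends on `T.n`, so the size is made a variable before substituting; a rotation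
  -- of at least two points fixes none.
  have key : ∀ (N : ℕ) (j : Fin N), N = n + 2 → j ≠ finRotate N j := by
    rintro N j rfl hj
    have : j ∈ (finRotate (n + 2)).support := by rw [support_finRotate]; simp
    exact (Equiv.Perm.mem_support.1 this) hj.symm
  exact key _ i hn h1

theorem lineMap_mem_edge {t : ℝ} (ht : t ∈ Icc (0 : ℝ) 1) :
    AffineMap.lineMap (T.vertex i) (T.vertex (finRotate T.n i)) t ∈ T.edge i := by
  rw [edge, segment_eq_image_lineMap]
  exact mem_image_of_mem _ ht

variable {T i}

theorem continuousOn_comp_lineMap {g : Plane → ℝ} (hg : ContinuousOn g (T.edge i)) :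
    ContinuousOn (fun t : ℝ =>
      g (AffineMap.lineMap (T.vertex i) (T.vertex (finRotate T.n i)) t)) (Icc 0 1) :=
  hg.comp AffineMap.lineMap_continuous.continuousOn fun _ ht => T.lineMap_mem_edge i ht

theorem intervalIntegrable_comp_lineMap {g : Plane → ℝ} (hg : ContinuousOn g (T.edge i)) :
    IntervalIntegrable (fun t : ℝ =>
      g (AffineMap.lineMap (T.vertex i) (T.vertex (finRotate T.n i)) t)) volume 0 1 := by
  apply ContinuousOn.intervalIntegrable
  rw [uIcc_of_le zero_le_one]
  exact continuousOn_comp_lineMap hg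

theorem edgeIntegral_add {g h : Plane → ℝ} (hg : ContinuousOn g (T.edge i))
    (hh : ContinuousOn h (T.edge i)) :
    T.edgeIntegral i (fun x => g x + h x) = T.edgeIntegral i g + T.edgeIntegral i h := by
  rw [edgeIntegral, intervalIntegral.integral_add (intervalIntegrable_comp_lineMap hg)
    (intervalIntegrable_comp_lineMap hh), mul_add]
  rfl

theorem edgeIntegral_const_mul (c : ℝ) (g : Plane → ℝ) :
    T.edgeIntegral i (fun x => c * g x) = c * T.edgeIntegral i g := by
  rw [edgeIntegral, intervalIntegral.integral_const_mul, edgeIntegral]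
  ring

theorem edgeIntegral_congr {g h : Plane → ℝ} (hgh : EqOn g h (T.edge i)) :
    T.edgeIntegral i g = T.edgeIntegral i h := by
  rw [edgeIntegral, edgeIntegral]
  congr 1
  refine intervalIntegral.integral_congr fun t ht => hgh (T.lineMap_mem_edge i ?_)
  rwa [uIcc_of_le zero_le_one] at ht

theorem edgeIntegral_mul_self_nonneg (g : Plane → ℝ) :
    0 ≤ T.edgeIntegral i (fun x => g x * g x) :=
  mul_nonneg dist_nonneg
    (intervalIntegral.integral_nonneg zero_le_one fun _ _ => mul_self_nonneg _)

theorem eq_zero_of_edgeIntegral_mul_self_eq_zero {g : Plane → ℝ}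
    (hg : ContinuousOn g (T.edge i)) (h : T.edgeIntegral i (fun x => g x * g x) = 0) :
    ∀ x ∈ T.edge i, g x = 0 := by
  intro x hx
  rw [edge, segment_eq_image_lineMap] at hx
  obtain ⟨t, ht, rfl⟩ := hx
  by_contra hne
  refine h.not_gt (mul_pos (T.dist_pos i) (intervalIntegral.integral_pos zero_lt_one
    (continuousOn_comp_lineMap (hg.mul hg)) (fun _ _ => mul_self_nonneg _)
    ⟨t, ht, mul_self_pos.2 hne⟩))

end Polygon

/-! ### Polynomials on an edge and linearity of the projection Q_b -/

theorem continuousOn_polyOn {e : Set Plane} {m : ℕ} (p : polyOn e m) : ContinuousOn p.1 e := by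
  obtain ⟨P, -, hP⟩ := p.2
  rw [← hP]
  exact (continuous_pval P).continuousOn.congr fun x hx => indicator_of_mem hx _

theorem polyOn_eq_zero_of_notMem {e : Set Plane} {m : ℕ} (p : polyOn e m) {x : Plane}
    (hx : x ∉ e) : p.1 x = 0 := by
  obtain ⟨P, -, hP⟩ := p.2
  rw [← hP]
  exact indicator_of_notMem hx _

instance finiteDimensional_polyOn (e : Set Plane) (m : ℕ) : FiniteDimensional ℝ (polyOn e m) :=
  inferInstanceAs (FiniteDimensional ℝ ((Poly m).map (restrictTo e)))

theorem polyOn_eq_zero_of_edgeIntegral {T : Polygon} {i : Fin T.n} {m : ℕ}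
    (p : polyOn (T.edge i) m) (h : T.edgeIntegral i (fun x => p.1 x * p.1 x) = 0) : p = 0 := by
  ext x
  by_cases hx : x ∈ T.edge i
  · exact Polygon.eq_zero_of_edgeIntegral_mul_self_eq_zero (continuousOn_polyOn p) h x hx
  · exact polyOn_eq_zero_of_notMem p hx

/-- The pairing `q ↦ ∫_e g q` of a continuous function with polynomials on an edge. -/
def edgeLoad (T : Polygon) (i : Fin T.n) (m : ℕ) {g : Plane → ℝ}
    (hg : ContinuousOn g (T.edge i)) : polyOn (T.edge i) m →ₗ[ℝ] ℝ where
  toFun q := T.edgeIntegral i (fun x => g x * q.1 x)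
  map_add' p q := by
    refine Eq.trans ?_ (Polygon.edgeIntegral_add (hg.mul (continuousOn_polyOn p))
      (hg.mul (continuousOn_polyOn q)))
    congr 1; ext x; simp [mul_add]
  map_smul' c p := by
    rw [RingHom.id_apply, smul_eq_mul, ← Polygon.edgeIntegral_const_mul]
    congr 1; ext x; simp; ring

/-- The `L^2` inner product on an edge. -/
def edgeForm (T : Polygon) (i : Fin T.n) (m : ℕ) :
    polyOn (T.edge i) m →ₗ[ℝ] polyOn (T.edge i) m →ₗ[ℝ] ℝ where
  toFun p := edgeLoad T i m (continuousOn_polyOn p)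
  map_add' p q := by
    ext r
    simp only [edgeLoad, LinearMap.coe_mk, AddHom.coe_mk, LinearMap.add_apply]
    refine Eq.trans ?_ (Polygon.edgeIntegral_add
      ((continuousOn_polyOn p).mul (continuousOn_polyOn r))
      ((continuousOn_polyOn q).mul (continuousOn_polyOn r)))
    congr 1; ext x; simp [add_mul]
  map_smul' c p := by
    ext r
    simp only [edgeLoad, LinearMap.coe_mk, AddHom.coe_mk, LinearMap.smul_apply, RingHom.id_apply,
      smul_eq_mul]
    rw [← Polygon.edgeIntegral_const_mul]
    congr 1; ext x; simp [mul_assoc]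

theorem edgeForm_apply (T : Polygon) (i : Fin T.n) (m : ℕ) (p q : polyOn (T.edge i) m) :
    edgeForm T i m p q = T.edgeIntegral i (fun x => p.1 x * q.1 x) := rfl

theorem edgeForm_injective (T : Polygon) (i : Fin T.n) (m : ℕ) :
    Function.Injective (edgeForm T i m) := by
  rw [injective_iff_map_eq_zero]
  intro p hp
  exact polyOn_eq_zero_of_edgeIntegral p (by rw [← edgeForm_apply, hp]; rfl)

/-- Together with `edgeForm_injective` this determines the projection, so its linearity can be
checked on the right-hand sides. -/
theorem edgeForm_projEdge (T : Polygon) (i : Fin T.n) (m : ℕ) {g : Plane → ℝ}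
    (hg : ContinuousOn g (T.edge i)) : edgeForm T i m (projEdge m T i g) = edgeLoad T i m hg :=
  LinearMap.ext fun q => riesz_spec (edgeForm T i m)
    (fun p hp => polyOn_eq_zero_of_edgeIntegral p hp) (edgeLoad T i m hg) q

/-- The projection `Q_b` as a linear map on polynomials. -/
def projEdgeLinear (T : Polygon) (i : Fin T.n) (m : ℕ) :
    MvPolynomial (Fin 2) ℝ →ₗ[ℝ] polyOn (T.edge i) m where
  toFun p := projEdge m T i (pval p)
  map_add' p q := by
    apply edgeForm_injective
    have hp := (continuous_pval p).continuousOn (s := T.edge i)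
    have hq := (continuous_pval q).continuousOn (s := T.edge i)
    rw [map_add, edgeForm_projEdge _ _ _ hp, edgeForm_projEdge _ _ _ hq,
      edgeForm_projEdge _ _ _ (continuous_pval (p + q)).continuousOn]
    ext r
    simp only [edgeLoad, LinearMap.coe_mk, AddHom.coe_mk, LinearMap.add_apply]
    refine Eq.trans ?_ (Polygon.edgeIntegral_add (hp.mul (continuousOn_polyOn r))
      (hq.mul (continuousOn_polyOn r)))
    simp only [pval_add, add_mul]
  map_smul' c p := by
    apply edgeForm_injective
    have hp := (continuous_pval p).continuousOn (s := T.edge i)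
    rw [map_smul, edgeForm_projEdge _ _ _ hp,
      edgeForm_projEdge _ _ _ (continuous_pval (c • p)).continuousOn]
    ext r
    simp only [edgeLoad, LinearMap.coe_mk, AddHom.coe_mk, LinearMap.smul_apply, smul_eq_mul,
      RingHom.id_apply]
    rw [← Polygon.edgeIntegral_const_mul]
    simp only [pval_smul, mul_assoc]


/-! ### The weak gradient and the bilinear forms on V_h -/

section Forms

variable {Ω : Set Plane} {M : Mesh Ω} {k : ℕ}

instance finite_edge (M : Mesh Ω) : Finite M.Edge := by
  have hs : Function.Surjective
      fun p : (K : Fin M.N) × Fin (M.elem K).n => M.edgeOf p.1 p.2 := by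
    rintro ⟨_, K, i, rfl⟩
    exact ⟨⟨K, i⟩, rfl⟩
  exact Finite.of_surjective _ hs

instance finiteDimensional_Vh : FiniteDimensional ℝ (Vh M k) := by
  have := Fintype.ofFinite M.Edge
  infer_instance

/-- The map `v ↦ v₀|_K`. -/
def interiorPoly (K : Fin M.N) : Vh M k →ₗ[ℝ] MvPolynomial (Fin 2) ℝ :=
  (Poly k).subtype ∘ₗ LinearMap.proj K ∘ₗ LinearMap.fst ℝ _ _ ∘ₗ (Vh M k).subtype

theorem pval_interiorPoly (v : Vh M k) (K : Fin M.N) :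
    pval (interiorPoly K v) = interiorPart v K := rfl

/-- The map `v ↦ v_b|_e`, `e` the `i`-th edge of `K`. -/
def edgeTrace (K : Fin M.N) (i : Fin (M.elem K).n) :
    Vh M k →ₗ[ℝ] polyOn ((M.elem K).edge i) (k - 1) :=
  LinearMap.proj (M.edgeOf K i) ∘ₗ LinearMap.snd ℝ _ _ ∘ₗ (Vh M k).subtype

theorem edgeTrace_coe (v : Vh M k) (K : Fin M.N) (i : Fin (M.elem K).n) :
    (edgeTrace K i v).1 = edgePart v K i := rfl

/-- The `L²` inner product on `[P_m(K)]²`. -/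
def vectorForm (T : Polygon) (m : ℕ) :
    (Fin 2 → Poly m) →ₗ[ℝ] (Fin 2 → Poly m) →ₗ[ℝ] ℝ :=
  matrixForm T.isBounded_carrier T.isOpen_carrier (A := fun _ => 1)
    (fun _ _ => integrableOn_const T.isBounded_carrier.measure_lt_top.ne) m

theorem vectorForm_apply (T : Polygon) {m : ℕ} (G H : Fin 2 → Poly m) :
    vectorForm T m G H = ∫ x in T.carrier, ∑ l, pval (G l).1 x * pval (H l).1 x := by
  simp only [vectorForm, matrixForm_apply, Matrix.one_mulVec, dotProduct]

theorem eq_zero_of_vectorForm_self (T : Polygon) {m : ℕ} (G : Fin 2 → Poly m)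
    (h : vectorForm T m G G = 0) : G = 0 := by
  rw [vectorForm_apply] at h
  have h0 := eqOn_zero_of_setIntegral_eq_zero T.isBounded_carrier T.isOpen_carrier
    (continuous_finsetSum _ fun l _ => (continuous_pval _).mul (continuous_pval _))
    (fun x => Finset.sum_nonneg fun l _ => mul_self_nonneg _) h
  funext l
  refine Subtype.ext (eq_zero_of_pval_eq_zero T.isOpen_carrier T.isConnected_carrier.nonempty ?_)
  intro x hx
  have := (Finset.sum_eq_zero_iff_of_nonneg fun l _ => mul_self_nonneg _).1 (h0 x hx) l
    (Finset.mem_univ l)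
  exact mul_self_eq_zero.1 this

theorem vectorForm_injective (T : Polygon) (m : ℕ) : Function.Injective (vectorForm T m) := by
  rw [injective_iff_map_eq_zero]
  intro p hp
  exact eq_zero_of_vectorForm_self T p (by rw [hp]; rfl)

/-- The restriction of polynomials to `e`. -/
def polyTrace (e : Set Plane) (m : ℕ) : Poly m →ₗ[ℝ] polyOn e m :=
  (restrictTo e).submoduleMap (Poly m)

theorem polyTrace_apply {e : Set Plane} {m : ℕ} (p : Poly m) {x : Plane} (hx : x ∈ e) :
    (polyTrace e m p).1 x = pval p.1 x := indicator_of_mem hx _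

/-- The divergence on `[P_m]²`. -/
def polyDiv (m : ℕ) : (Fin 2 → Poly m) →ₗ[ℝ] MvPolynomial (Fin 2) ℝ :=
  ∑ l, (MvPolynomial.pderiv l).toLinearMap ∘ₗ (Poly m).subtype ∘ₗ LinearMap.proj l

/-- The right-hand side of the equation that defines the weak gradient. -/
def wgradLoad (K : Fin M.N) : Vh M k →ₗ[ℝ] (Fin 2 → Poly (k - 1)) →ₗ[ℝ] ℝ :=
  -(weightedForm (M.elem K).isBounded_carrier (M.elem K).isOpen_carrier
      (integrableOn_const_one (M.elem K).isBounded_carrier)).compl₁₂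
      (interiorPoly K) (polyDiv (k - 1)) +
    ∑ i, ∑ l, ((M.elem K).normal i) l •
      (edgeForm (M.elem K) i (k - 1)).compl₁₂ (edgeTrace K i)
        (polyTrace ((M.elem K).edge i) (k - 1) ∘ₗ LinearMap.proj l)

theorem wgradLoad_apply (v : Vh M k) (K : Fin M.N) (q : Fin 2 → Poly (k - 1)) :
    wgradLoad K v q =
      -(∫ x in (M.elem K).carrier,
          interiorPart v K x * pval (∑ l, MvPolynomial.pderiv l (q l).1) x) +
        ∑ i, (M.elem K).edgeIntegral i
          (fun x => edgePart v K i x * ∑ l, pval (q l).1 x * ((M.elem K).normal i) l) := by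
  simp only [wgradLoad, LinearMap.add_apply, LinearMap.neg_apply, LinearMap.compl₁₂_apply,
    weightedForm_apply, LinearMap.sum_apply, one_mul, pval_interiorPoly]
  refine congrArg₂ (· + ·) ?_ ?_
  · simp [polyDiv]
  · refine Finset.sum_congr rfl fun i _ => ?_
    have hb : ContinuousOn (edgePart v K i) ((M.elem K).edge i) :=
      continuousOn_polyOn (edgeTrace K i v)
    have hl : ∀ l, edgeForm (M.elem K) i (k - 1) (edgeTrace K i v)
        (polyTrace ((M.elem K).edge i) (k - 1) (q l)) =
        (M.elem K).edgeIntegral i (fun x => edgePart v K i x * pval (q l).1 x) := by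
      intro l
      rw [edgeForm_apply]
      refine Polygon.edgeIntegral_congr fun x hx => ?_
      simp only [polyTrace_apply _ hx, edgeTrace_coe]
    have hc : ∀ l (c : ℝ), ContinuousOn (fun x => c * (edgePart v K i x * pval (q l).1 x))
        ((M.elem K).edge i) := fun l c =>
      continuousOn_const.mul (hb.mul (continuous_pval _).continuousOn)
    simp only [LinearMap.smul_apply, LinearMap.compl₁₂_apply, LinearMap.comp_apply,
      LinearMap.proj_apply, hl, Fin.sum_univ_two, smul_eq_mul]
    rw [← Polygon.edgeIntegral_const_mul, ← Polygon.edgeIntegral_const_mul,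
      ← Polygon.edgeIntegral_add (hc _ _) (hc _ _)]
    congr 1; ext x; ring

/-- The load is linear in v and the L² form is injective, so the chosen weak gradient is linear in v
as well. -/
theorem vectorForm_wgrad (v : Vh M k) (K : Fin M.N) :
    vectorForm (M.elem K) (k - 1) (wgrad v K) = wgradLoad K v := by
  refine LinearMap.ext fun q => ?_
  have h := riesz_spec (vectorForm (M.elem K) (k - 1))
    (fun p hp => eq_zero_of_vectorForm_self _ p hp) (wgradLoad K v) q
  simp only [vectorForm_apply, wgradLoad_apply] at h ⊢
  exact h

/-- The weak gradient as a linear map. -/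
def wgradLinear (K : Fin M.N) : Vh M k →ₗ[ℝ] (Fin 2 → Poly (k - 1)) where
  toFun v := wgrad v K
  map_add' v w := by
    apply vectorForm_injective (M.elem K)
    rw [map_add]
    simp only [vectorForm_wgrad, map_add]
  map_smul' c v := by
    apply vectorForm_injective (M.elem K)
    rw [map_smul]
    simp only [vectorForm_wgrad, map_smul, RingHom.id_apply]

/-- The map `v ↦ Q_b v₀ - v_b`. -/
def jump (K : Fin M.N) (i : Fin (M.elem K).n) :
    Vh M k →ₗ[ℝ] polyOn ((M.elem K).edge i) (k - 1) :=
  projEdgeLinear (M.elem K) i (k - 1) ∘ₗ interiorPoly K - edgeTrace K i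

/-- The bilinear form `∑_K ∫_K g v₀ w₀`. -/
def weightedBilin {g : Plane → ℝ} (hg : ∀ K, IntegrableOn g (M.elem K).carrier) :
    Vh M k →ₗ[ℝ] Vh M k →ₗ[ℝ] ℝ :=
  ∑ K, (weightedForm (M.elem K).isBounded_carrier (M.elem K).isOpen_carrier (hg K)).compl₁₂
    (interiorPoly K) (interiorPoly K)

theorem weightedBilin_apply {g : Plane → ℝ} (hg : ∀ K, IntegrableOn g (M.elem K).carrier)
    (v w : Vh M k) : weightedBilin hg v w =
      ∑ K, ∫ x in (M.elem K).carrier, g x * interiorPart v K x * interiorPart w K x := by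
  simp only [weightedBilin, LinearMap.sum_apply, LinearMap.compl₁₂_apply, weightedForm_apply,
    pval_interiorPoly]

/-- The `L²` inner product as a bilinear form. -/
def massBilin : Vh M k →ₗ[ℝ] Vh M k →ₗ[ℝ] ℝ :=
  weightedBilin fun K => integrableOn_const_one (M.elem K).isBounded_carrier

theorem massBilin_apply (v w : Vh M k) : massBilin v w = massForm v w := by
  simp only [massBilin, weightedBilin_apply, one_mul, massForm]

/-- The stabilizer as a bilinear form. -/
def stabBilin (ε : ℝ) : Vh M k →ₗ[ℝ] Vh M k →ₗ[ℝ] ℝ :=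
  ∑ K, (M.elem K).diam ^ (-1 + ε) •
    ∑ i, (edgeForm (M.elem K) i (k - 1)).compl₁₂ (jump K i) (jump K i)

theorem stabBilin_apply (ε : ℝ) (v w : Vh M k) : stabBilin ε v w = stab ε v w := by
  simp only [stabBilin, LinearMap.sum_apply, LinearMap.smul_apply, LinearMap.compl₁₂_apply,
    edgeForm_apply, smul_eq_mul]
  rfl

/-- The form of `A_h^u` as a bilinear form. -/
def AhuBilin (ε : ℝ) {A : Plane → Matrix (Fin 2) (Fin 2) ℝ} {V g : Plane → ℝ}
    (hA : ∀ K i j, IntegrableOn (fun x => A x i j) (M.elem K).carrier)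
    (hV : ∀ K, IntegrableOn V (M.elem K).carrier)
    (hg : ∀ K, IntegrableOn g (M.elem K).carrier) : Vh M k →ₗ[ℝ] Vh M k →ₗ[ℝ] ℝ :=
  ∑ K, (matrixForm (M.elem K).isBounded_carrier (M.elem K).isOpen_carrier (hA K)
      (k - 1)).compl₁₂ (wgradLinear K) (wgradLinear K) +
    weightedBilin hV + stabBilin ε + weightedBilin hg

theorem AhuBilin_apply (ε : ℝ) {A : Plane → Matrix (Fin 2) (Fin 2) ℝ} {V : Plane → ℝ}
    {F : ℝ → ℝ} {u : Plane → ℝ}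
    (hA : ∀ K i j, IntegrableOn (fun x => A x i j) (M.elem K).carrier)
    (hV : ∀ K, IntegrableOn V (M.elem K).carrier)
    (hg : ∀ K, IntegrableOn (fun x => nonlin F (u x ^ 2)) (M.elem K).carrier) (v w : Vh M k) :
    AhuBilin ε hA hV hg v w = Ahu ε A V F u v w := by
  simp only [AhuBilin, LinearMap.add_apply, LinearMap.sum_apply, LinearMap.compl₁₂_apply,
    matrixForm_apply, weightedBilin_apply, stabBilin_apply, Ahu, ah]
  rfl

/-! ### Symmetry and definiteness -/

theorem massForm_symm (v w : Vh M k) : massForm v w = massForm w v := by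
  simp only [massForm, mul_comm]

theorem stab_symm (ε : ℝ) (v w : Vh M k) : stab ε v w = stab ε w v := by
  simp only [stab]
  refine Finset.sum_congr rfl fun K _ => ?_
  congr 1
  refine Finset.sum_congr rfl fun i _ => ?_
  congr 1; ext x; ring

theorem Ahu_symm (ε : ℝ) {A : Plane → Matrix (Fin 2) (Fin 2) ℝ} (V : Plane → ℝ)
    (F : ℝ → ℝ) (u : Plane → ℝ)
    (hA : ∀ K, ∀ᵐ x ∂(volume.restrict (M.elem K).carrier), (A x).IsSymm) (v w : Vh M k) :
    Ahu ε A V F u v w = Ahu ε A V F u w v := by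
  rw [Ahu, Ahu, ah, ah, stab_symm ε v w]
  have h1 : ∀ (g : Plane → ℝ) (K : Fin M.N),
      ∫ x in (M.elem K).carrier, g x * interiorPart v K x * interiorPart w K x =
        ∫ x in (M.elem K).carrier, g x * interiorPart w K x * interiorPart v K x := by
    intro g K; congr 1; ext x; ring
  have h2 : ∀ K : Fin M.N,
      ∫ x in (M.elem K).carrier,
        (A x *ᵥ (fun l => pval (wgrad v K l).1 x)) ⬝ᵥ (fun l => pval (wgrad w K l).1 x) =
      ∫ x in (M.elem K).carrier,
        (A x *ᵥ (fun l => pval (wgrad w K l).1 x)) ⬝ᵥ (fun l => pval (wgrad v K l).1 x) := by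
    intro K
    refine integral_congr_ae ?_
    filter_upwards [hA K] with x hx
    rw [dotProduct_comm, Matrix.dotProduct_mulVec, ← Matrix.mulVec_transpose, hx.eq]
  simp only [h1 V, h1 (fun x => nonlin F (u x ^ 2)), h2]

theorem massForm_self_nonneg (v : Vh M k) : 0 ≤ massForm v v :=
  Finset.sum_nonneg fun _ _ => integral_nonneg fun _ => mul_self_nonneg _

theorem interiorPoly_eq_zero_of_massForm {v : Vh M k} (h : massForm v v = 0) (K : Fin M.N) :
    interiorPoly K v = 0 := by
  rw [massForm, Finset.sum_eq_zero_iff_of_nonneg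
    fun _ _ => integral_nonneg fun _ => mul_self_nonneg _] at h
  have h0 := eqOn_zero_of_setIntegral_eq_zero (M.elem K).isBounded_carrier
    (M.elem K).isOpen_carrier ((continuous_pval _).mul (continuous_pval _))
    (fun x => mul_self_nonneg _) (h K (Finset.mem_univ K))
  exact eq_zero_of_pval_eq_zero (M.elem K).isOpen_carrier (M.elem K).isConnected_carrier.nonempty
    fun x hx => mul_self_eq_zero.1 (h0 x hx)

theorem eq_zero_of_parts {v : Vh M k} (h0 : ∀ K, interiorPoly K v = 0)
    (hb : ∀ K i, edgeTrace K i v = 0) : v = 0 := by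
  refine Subtype.ext (Prod.ext (funext fun K => Subtype.ext (h0 K)) (funext ?_))
  rintro ⟨_, K, i, rfl⟩
  exact hb K i

theorem Polygon.diam_pos (T : Polygon) : 0 < T.diam := by
  obtain ⟨x, hx⟩ := T.isConnected_carrier.nonempty
  have hnt : T.carrier.Nontrivial :=
    (infinite_of_mem_nhds x (T.isOpen_carrier.mem_nhds hx)).nontrivial
  obtain ⟨y, hy, z, hz, hyz⟩ := hnt
  exact (_root_.dist_pos.2 hyz).trans_le (Metric.dist_le_diam_of_mem T.isBounded_carrier hy hz)

theorem stab_self_nonneg (ε : ℝ) (v : Vh M k) : 0 ≤ stab ε v v :=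
  Finset.sum_nonneg fun K _ => mul_nonneg (Real.rpow_nonneg (M.elem K).diam_pos.le _)
    (Finset.sum_nonneg fun _ _ => Polygon.edgeIntegral_mul_self_nonneg _)

/-- The stabilizer is a sum of squared edge norms with strictly positive weights, so each norm
vanishes. -/
theorem jump_eq_zero_of_stab {ε : ℝ} {v : Vh M k} (h : stab ε v v = 0) (K : Fin M.N)
    (i : Fin (M.elem K).n) : jump K i v = 0 := by
  have hnn : ∀ (K : Fin M.N) (i : Fin (M.elem K).n),
      0 ≤ edgeForm (M.elem K) i (k - 1) (jump K i v) (jump K i v) :=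
    fun _ _ => Polygon.edgeIntegral_mul_self_nonneg _
  rw [← stabBilin_apply] at h
  simp only [stabBilin, LinearMap.sum_apply, LinearMap.smul_apply, LinearMap.compl₁₂_apply,
    smul_eq_mul] at h
  rw [Finset.sum_eq_zero_iff_of_nonneg fun K _ =>
    mul_nonneg (Real.rpow_nonneg (M.elem K).diam_pos.le _)
      (Finset.sum_nonneg fun i _ => hnn K i)] at h
  have h1 := (mul_eq_zero.1 (h K (Finset.mem_univ K))).resolve_left
    (Real.rpow_pos_of_pos (M.elem K).diam_pos _).ne'
  rw [Finset.sum_eq_zero_iff_of_nonneg fun i _ => hnn K i] at h1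
  exact polyOn_eq_zero_of_edgeIntegral _ (h1 i (Finset.mem_univ i))

/-- Zero mass forces v₀ = 0, which removes the V and f(u²) terms whatever their signs. The jump is
then -v_b, so a vanishing stabilizer would give v = 0. -/
theorem Ahu_self_pos (ε : ℝ) {A : Plane → Matrix (Fin 2) (Fin 2) ℝ} (V : Plane → ℝ)
    (F : ℝ → ℝ) (u : Plane → ℝ)
    (hA : ∀ K, ∀ᵐ x ∂(volume.restrict (M.elem K).carrier), ∀ ξ : Fin 2 → ℝ,
      0 ≤ (A x *ᵥ ξ) ⬝ᵥ ξ) {v : Vh M k} (hm : massForm v v = 0) (hv : v ≠ 0) :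
    0 < Ahu ε A V F u v v := by
  have h0 := interiorPoly_eq_zero_of_massForm hm
  have h0' : ∀ K x, interiorPart v K x = 0 := fun K x => by
    rw [← pval_interiorPoly, h0 K, pval_zero]
  have hstab : 0 < stab ε v v := by
    refine lt_of_le_of_ne (stab_self_nonneg ε v) fun h => hv ?_
    refine eq_zero_of_parts h0 fun K i => ?_
    have := jump_eq_zero_of_stab h.symm K i
    simpa [jump, h0 K] using this
  have hgrad : 0 ≤ ∑ K, ∫ x in (M.elem K).carrier,
      (A x *ᵥ (fun l => pval (wgrad v K l).1 x)) ⬝ᵥ (fun l => pval (wgrad v K l).1 x) :=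
    Finset.sum_nonneg fun K _ => integral_nonneg_of_ae ((hA K).mono fun x hx => hx _)
  simp only [Ahu, ah, h0', mul_zero, integral_zero, Finset.sum_const_zero, add_zero]
  linarith

end Forms

/-! ### Integrability of the coefficients -/

/-- The cover only places elements in the closure of Ω; an open convex set is the interior of its
closure, and elements are open. -/
theorem Mesh.carrier_subset {Ω : Set Plane} (M : Mesh Ω) (ho : IsOpen Ω) (hne : Ω.Nonempty)
    (hc : Convex ℝ Ω) (K : Fin M.N) : (M.elem K).carrier ⊆ Ω := by
  have h1 : (M.elem K).carrier ⊆ closure Ω :=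
    subset_closure.trans ((subset_iUnion (fun K => closure (M.elem K).carrier) K).trans
      M.cover.subset)
  have h2 := interior_maximal h1 (M.elem K).isOpen_carrier
  rwa [hc.interior_closure_eq_interior_of_nonempty_interior (by rwa [ho.interior_eq]),
    ho.interior_eq] at h2

theorem integrableOn_nonlin {Ω : Set Plane} (hb : Bornology.IsBounded Ω)
    {F : ℝ → ℝ} (hA2 : AssumptionA2 F) (hA3 : AssumptionA3 F) {u : Plane → ℝ}
    (hu : MemH10 Ω u) : IntegrableOn (fun x => nonlin F (u x ^ 2)) Ω := by
  have h4 := hu.memLp_four hb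
  obtain ⟨q, hq0, hq2, C, hC⟩ := hA3
  have hcont : ContinuousOn (nonlin F) (Ici 0) :=
    hA2.1.continuousOn_derivWithin (uniqueDiffOn_Ici 0) le_rfl
  have hcont' : Continuous fun t : ℝ => nonlin F (t ^ 2) :=
    hcont.comp_continuous (by fun_prop) fun t => sq_nonneg t
  have hint : IntegrableOn (fun x => |C| * (2 + u x ^ 4)) Ω := by
    refine Integrable.const_mul (Integrable.add ?_ ?_) _
    · exact integrableOn_const hb.measure_lt_top.ne
    · have := h4.integrable_norm_pow (p := 4) (by norm_num)
      refine this.congr (Eventually.of_forall fun x => ?_)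
      simp only [Real.norm_eq_abs]
      exact Even.pow_abs (by decide) _
  refine hint.mono' (hcont'.comp_aestronglyMeasurable h4.1) (Eventually.of_forall fun x => ?_)
  have hs : (0 : ℝ) ≤ u x ^ 2 := sq_nonneg _
  -- For u² ≤ 1 the power is at most 1; otherwise q ≤ 2 bounds it by u⁴, which is integrable.
  have hpow : (u x ^ 2) ^ q ≤ 1 + u x ^ 4 := by
    rcases le_total (u x ^ 2) 1 with h | h
    · have := Real.rpow_le_one hs h hq0
      have : 0 ≤ u x ^ 4 := by positivity
      linarith
    · have := Real.rpow_le_rpow_of_exponent_le h hq2.le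
      rw [Real.rpow_two] at this
      nlinarith
  rw [Real.norm_eq_abs]
  calc |nonlin F (u x ^ 2)| ≤ C * (1 + (u x ^ 2) ^ q) := hC _ hs
    _ ≤ |C| * (1 + (u x ^ 2) ^ q) :=
        mul_le_mul_of_nonneg_right (le_abs_self C) (by positivity)
    _ ≤ |C| * (2 + u x ^ 4) := mul_le_mul_of_nonneg_left (by linarith) (abs_nonneg C)

end WG

end

/-! ### The Rayleigh bound on V_h and the conclusion -/

theorem WG.exists_eigenpair_mul_massForm_le {Ω : Set WG.Plane} {M : WG.Mesh Ω} {k : ℕ}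
    {b : WG.Vh M k → WG.Vh M k → ℝ} (B : WG.Vh M k →ₗ[ℝ] WG.Vh M k →ₗ[ℝ] ℝ)
    (hBb : ∀ v w, B v w = b v w) (hsymm : ∀ v w, b v w = b w v)
    (hpos : ∀ v, WG.massForm v v = 0 → v ≠ 0 → 0 < b v v)
    (hne : ∃ v : WG.Vh M k, WG.massForm v v ≠ 0) :
    ∃ w : WG.Vh M k, ∃ μ : ℝ, w ≠ 0 ∧ (∀ v, b w v = μ * WG.massForm w v) ∧
      ∀ v, μ * WG.massForm v v ≤ b v v := by
  obtain rfl : (fun v w => B v w) = b := funext₂ hBb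
  have hm : (fun v w => WG.massBilin v w) = WG.massForm (M := M) (k := k) :=
    funext₂ WG.massBilin_apply
  have hm0 := WG.massForm_self_nonneg (M := M) (k := k)
  have hms := WG.massForm_symm (M := M) (k := k)
  rw [← hm] at hpos hne hm0 hms ⊢
  exact WG.exists_eigenpair_le B WG.massBilin hsymm hms hm0 hpos hne

theorem mainTheorem11
    (Ω : Set WG.Plane) (hΩ_open : IsOpen Ω) (hΩ_nonempty : Ω.Nonempty)
    (hΩ_bounded : Bornology.IsBounded Ω) (hΩ_convex : Convex ℝ Ω)
    (A : WG.Plane → Matrix (Fin 2) (Fin 2) ℝ) (hA : WG.IsDiffusionMatrix Ω A)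
    (V : WG.Plane → ℝ) (hV : WG.IsPotential Ω V)
    (F : ℝ → ℝ)
    (hA1 : WG.AssumptionA1 Ω A) (hA2 : WG.AssumptionA2 F) (hA3 : WG.AssumptionA3 F)
    (u : WG.Plane → ℝ) (hu : WG.IsGroundState Ω A V F u)
    (M : WG.Mesh Ω) (k : ℕ) (hk : 1 ≤ k)
    (ε : ℝ) (hε_pos : 0 < ε) (hε_lt : ε < 1)
    (u_tilde : WG.Vh M k) (lam_tilde : ℝ)
    (h_first : WG.IsFirstEigenpair ε A V F u u_tilde lam_tilde) :
    ∀ v : WG.Vh M k, 0 ≤ WG.Ahu ε A V F u v v - lam_tilde * WG.massForm v v := by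
  have hsub := M.carrier_subset hΩ_open hΩ_nonempty hΩ_convex
  have : IsFiniteMeasure (volume.restrict Ω) := ⟨by
    rw [Measure.restrict_apply_univ]; exact hΩ_bounded.measure_lt_top⟩
  have hAint : ∀ K i j, IntegrableOn (fun x => A x i j) (M.elem K).carrier := fun K i j =>
    IntegrableOn.mono_set ((hA.1 i j).integrable le_top) (hsub K)
  have hVint : ∀ K, IntegrableOn V (M.elem K).carrier := fun K =>
    IntegrableOn.mono_set (hV.1.integrable (by norm_num)) (hsub K)
  have hgint : ∀ K, IntegrableOn (fun x => WG.nonlin F (u x ^ 2)) (M.elem K).carrier := fun K =>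
    (WG.integrableOn_nonlin hΩ_bounded hA2 hA3 hu.1).mono_set (hsub K)
  have hsymm : ∀ K, ∀ᵐ x ∂(volume.restrict (M.elem K).carrier), (A x).IsSymm := fun K =>
    ae_restrict_of_ae_restrict_of_subset (hsub K) hA.2
  obtain ⟨α, hα, hell⟩ := hA1
  have hpsd : ∀ K, ∀ᵐ x ∂(volume.restrict (M.elem K).carrier), ∀ ξ : Fin 2 → ℝ,
      0 ≤ (A x *ᵥ ξ) ⬝ᵥ ξ := fun K => by
    filter_upwards [ae_restrict_of_ae_restrict_of_subset (hsub K) hell] with x hx ξ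
    rw [dotProduct_comm]
    exact (mul_nonneg hα.le (Finset.sum_nonneg fun i _ => mul_self_nonneg (ξ i))).trans (hx ξ)
  obtain ⟨⟨hne, heig⟩, hmin⟩ := h_first
  -- If the mass vanished, testing the eigenvalue equation with the eigenvector itself would make
  -- the form zero, against its positivity.
  have hmne : WG.massForm u_tilde u_tilde ≠ 0 := fun h => by
    have h1 := WG.Ahu_self_pos ε V F u hpsd h hne
    rw [heig u_tilde, h, mul_zero] at h1
    exact lt_irrefl _ h1
  have hle := WG.exists_eigenpair_mul_massForm_le (WG.AhuBilin ε hAint hVint hgint)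
    (WG.AhuBilin_apply ε hAint hVint hgint) (WG.Ahu_symm ε V F u hsymm)
    (fun v => WG.Ahu_self_pos ε V F u hpsd) ⟨u_tilde, hmne⟩
  obtain ⟨w, μ, hw, hwe, hle⟩ := hle
  intro v
  -- Only here does minimality of the given eigenvalue enter: it is at most the μ of the Rayleigh
  -- bound.
  have h1 := mul_le_mul_of_nonneg_right (hmin w μ ⟨hw, hwe⟩) (WG.massForm_self_nonneg v)
  linarith [hle v]
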